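/- **Definitions.** A search problem $S\subseteq\mathcal I\times\mathcal O$ is *total* if every $x\in\mathcal I$ has some $o$ with $(x,o)\in S$; let $S^{-1}(o)=\{x:(x,o)\in S\}$. Given a family $\mathcal F$ of functions $\mathcal I\to\{0,1\}$, an *$\mathcal F$-dag solving $S$* is a finite directed acyclic graph of out-degree at most $2$ in which every vertex $v$ carries some $f_v\in\mathcal F$ and: a designated root of in-degree $0$ has $f_{\mathrm{root}}\equiv 1$; every non-leaf $v$ with children $u,u'$ (perhaps equal) has $f_v^{-1}(1)\subseteq f_u^{-1}(1)\cup f_{u'}^{-1}(1)$; every leaf $v$ has some $o\in\mathcal O$ with $f_v^{-1}(1)\subseteq S^{-1}(o)$. Its *size* is its number of vertices. When the inputs are encoded by Boolean variables, *decision-dags* use conjunctions of literals as $\mathcal F$ and *LTF-dags* (the dags of semantic Cutting Planes) use linear threshold functions $[\sum_v a_v x_v\ge\theta]$ with real coefficients. On a product domain $\prod_p \mathcal I_p$, *simplex-dags* use the functions $f$ for which every $\mathcal I_p$ has a total order $\preceq_p$ (depending on $f$) such that $f$ is nondecreasing in the product order. Write $\mathrm{decDag}(S)$, $\mathrm{ltfDag}(S)$,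 $\mathrm{simDag}(S)$ for the least size of such a dag solving $S$. For $S\subseteq(\{0,1\}^\ell)^n\times\mathcal O$, the *block-width* $\mathrm{bw}(\Pi)$ of a decision-dag $\Pi$ solving $S$ is the maximum, over the conjunctions in $\Pi$, of the number of the $n$ blocks from which the conjunction contains a variable or its negation; $\mathrm{bw}(S)$ is the least block-width of a decision-dag solving $S$. The *column-index gadget* $\mathrm{Ind}_{\ell\times m}:[m]\times\{0,1\}^{\ell\times m}\to\{0,1\}^\ell$ maps $(x,y)$ to the $x$-th column of $y$. The problem $S\circ\mathrm{Ind}^n_{\ell\times m}\subseteq[m]^n\times(\{0,1\}^{\ell\times m})^n\times\mathcal O$ is, on input $(x,y)$, to find some $o$ with $(z,o)\in S$ for $z=(\mathrm{Ind}_{\ell\times m}(x_1,y_1),\dots,\mathrm{Ind}_{\ell\times m}(x_n,y_n))$. For decision-dags and LTF-dags its Boolean variables are the entries of the matrices $y_i$ and the bits of the binary encodings of the pointers $x_i$, with $\lceil\log_2 m\rceil$ bits each. For simplex-dags its domain is viewed as the $(1+n\ell)$-partite product $[m]^n\times\prod_{(i,j)\in[n]\times[\ell]}\{0,1\}^m$,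 where part $(i,j)$ is the $j$-th row of $y_i$. **Theorem.** There are absolute constants $c,C>0$ such that for all $n,\ell$, with $m:=(n\ell)^5$, and for every total search problem $S\subseteq(\{0,1\}^\ell)^n\times\mathcal O$, $$m^{c\cdot \mathrm{bw}(S)}\le \mathrm{simDag}(S\circ\mathrm{Ind}^n_{\ell\times m})\le \mathrm{ltfDag}(S\circ\mathrm{Ind}^n_{\ell\times m})\le \mathrm{decDag}(S\circ\mathrm{Ind}^n_{\ell\times m})\le m^{C\cdot \mathrm{bw}(\Pi)}\cdot|\Pi|,$$ where $\Pi$ is any decision-dag solving $S$, of size $|\Pi|$ and block-width $\mathrm{bw}(\Pi)$; in particular all these minima exist. -/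

import Mathlib

namespace BlockLift

/-- A search problem `S ⊆ I × O`: `S x o` says that `o` is a correct output on input `x`. -/
abbrev SearchProblem (I O : Type*) := I → O → Prop

/-- Every input has at least one correct output. -/
def TotalSearch {I O : Type*} (S : SearchProblem I O) : Prop := ∀ x, ∃ o, S x o

/-- A dag solving the search problem `S`, in the model whose admissible feasible sets are the sets
`feas a`, for `a : L` (so the associated family of Boolean functions consists of the indicators
of the sets `feas a`). The vertices are `Fin size`; `child v = none` says that `v` is a leaf, and
`child v = some (u, u')` says that `v` is a non-leaf with children `u` and `u'` (perhaps equal). -/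
structure Dag {I O L : Type*} (feas : L → Set I) (S : SearchProblem I O) where
  /-- The number of vertices. -/
  size : ℕ
  child : Fin size → Option (Fin size × Fin size)
  /-- The function (represented by an element of `L`) associated with a vertex. -/
  label : Fin size → L
  root : Fin size
  /-- There is no directed cycle. -/
  acyclic : ∀ v, ¬ Relation.TransGen
    (fun a b => ∃ u u', child a = some (u, u') ∧ (b = u ∨ b = u')) v v
  /-- The root has in-degree zero. -/
  root_source : ∀ v u u', child v = some (u, u') → u ≠ root ∧ u' ≠ root
  root_full : feas (label root) = Set.univ
  nonleaf : ∀ v u u', child v = some (u, u') →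
    feas (label v) ⊆ feas (label u) ∪ feas (label u')
  leaf : ∀ v, child v = none → ∃ o, ∀ x ∈ feas (label v), S x o

/-- The least size of a dag solving `S`. -/
noncomputable def leastSize {I O L : Type*} (feas : L → Set I) (S : SearchProblem I O) : ℕ :=
  sInf {s | ∃ P : Dag feas S, P.size = s}

/-! ### Decision-dags and LTF-dags

The inputs are elements of `I`, encoded by Boolean variables indexed by `V` through
`bit : V → I → Bool`. -/

/-- A conjunction of literals: `(v, true)` is the literal `v`, and `(v, false)` its negation. -/
abbrev Conj (V : Type*) := Finset (V × Bool)

/-- The set of inputs that satisfy a conjunction. -/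
def Conj.feas {I V : Type*} (bit : V → I → Bool) (C : Conj V) : Set I :=
  {x | ∀ p ∈ C, bit p.1 x = p.2}

abbrev DecisionDag {I O V : Type*} (bit : V → I → Bool) (S : SearchProblem I O) :=
  Dag (Conj.feas bit) S

noncomputable def decDag {I O V : Type*} (bit : V → I → Bool) (S : SearchProblem I O) : ℕ :=
  leastSize (Conj.feas bit) S

/-- A linear threshold function, given by its coefficients and its threshold. -/
abbrev LTF (V : Type*) := (V → ℝ) × ℝ

/-- The set of inputs that satisfy `∑ v, a v * v ≥ θ`. -/
def LTF.feas {I V : Type*} [Fintype V] (bit : V → I → Bool) (a : LTF V) : Set I :=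
  {x | a.2 ≤ ∑ v, a.1 v * (if bit v x then 1 else 0)}

abbrev LTFDag {I O V : Type*} [Fintype V] (bit : V → I → Bool) (S : SearchProblem I O) :=
  Dag (LTF.feas bit) S

noncomputable def ltfDag {I O V : Type*} [Fintype V] (bit : V → I → Bool)
    (S : SearchProblem I O) : ℕ :=
  leastSize (LTF.feas bit) S

/-! ### Simplex-dags -/

/-- A subset `A` of a product `∏ i, D i` is a simplex if each part `D i` has a total order such
that `A` is upward closed in the product order. -/
def IsSimplex {ι : Type*} {D : ι → Type*} (A : Set (∀ i, D i)) : Prop :=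
  ∃ ord : ∀ i, LinearOrder (D i),
    ∀ x y : ∀ i, D i, (∀ i, (ord i).le (x i) (y i)) → x ∈ A → y ∈ A

/-- The feasible set of a simplex is the simplex itself. -/
def simplexFeas {ι : Type*} {D : ι → Type*} (A : {A : Set (∀ i, D i) // IsSimplex A}) :
    Set (∀ i, D i) := A.1

abbrev SimplexDag {ι O : Type*} {D : ι → Type*} (S : SearchProblem (∀ i, D i) O) :=
  Dag simplexFeas S

noncomputable def simDag {ι O : Type*} {D : ι → Type*} (S : SearchProblem (∀ i, D i) O) : ℕ :=
  leastSize simplexFeas S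

/-! ### Blocks -/

/-- `({0,1}^ℓ)^n`: `n` blocks of `ℓ` bits each. -/
abbrev BlockInput (n ℓ : ℕ) := Fin n → Fin ℓ → Bool

/-- The Boolean variables of a block input: variable `(i, j)` is the `j`-th bit of block `i`. -/
def blockBit {n ℓ : ℕ} (v : Fin n × Fin ℓ) (z : BlockInput n ℓ) : Bool := z v.1 v.2

/-- The number of blocks that a conjunction touches. -/
def Conj.blockWidth {n ℓ : ℕ} (C : Conj (Fin n × Fin ℓ)) : ℕ :=
  (C.image fun p => p.1.1).card

/-- The maximum block-width of a conjunction in the dag. -/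
def blockWidth {n ℓ : ℕ} {O : Type*} {S : SearchProblem (BlockInput n ℓ) O}
    (P : DecisionDag blockBit S) : ℕ :=
  Finset.univ.sup fun v => (P.label v).blockWidth

/-- The least block-width of a decision-dag solving `S`. -/
noncomputable def bw {n ℓ : ℕ} {O : Type*} (S : SearchProblem (BlockInput n ℓ) O) : ℕ :=
  sInf {b | ∃ P : DecisionDag blockBit S, blockWidth P = b}

/-! ### Composition with the column-index gadget -/

/-- The column-index gadget: the `x`-th column of the `ℓ × m` matrix `y`. -/
def colIndex {ℓ m : ℕ} (x : Fin m) (y : Fin ℓ → Fin m → Bool) : Fin ℓ → Bool := fun j => y j x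

/-- `[m]^n × ({0,1}^{ℓ×m})^n`: a pointer and a matrix for every block. -/
abbrev LiftedInput (n ℓ m : ℕ) := (Fin n → Fin m) × (Fin n → Fin ℓ → Fin m → Bool)

/-- The composed search problem: solve `S` on the outputs of the `n` gadgets. -/
def compInd {n ℓ : ℕ} {O : Type*} (S : SearchProblem (BlockInput n ℓ) O) (m : ℕ) :
    SearchProblem (LiftedInput n ℓ m) O :=
  fun w => S fun i => colIndex (w.1 i) (w.2 i)

/-- The Boolean variables of the composed problem: the bits of the binary encodings of the
pointers, `⌈log₂ m⌉` for each of them, and the entries of the matrices. -/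
abbrev LiftedVar (n ℓ m : ℕ) := (Fin n × Fin (Nat.clog 2 m)) ⊕ (Fin n × Fin ℓ × Fin m)

/-- The value of a Boolean variable of the composed problem. -/
def liftedBit {n ℓ m : ℕ} : LiftedVar n ℓ m → LiftedInput n ℓ m → Bool
  | Sum.inl (i, t), w => (w.1 i : ℕ).testBit t
  | Sum.inr (i, j, c), w => w.2 i j c

/-- The `1 + n * ℓ` players: `none` is Alice, who holds all the pointers, and `some (i, j)` is the
Bob who holds the `j`-th row of the `i`-th matrix. -/
def Part (n ℓ m : ℕ) : Option (Fin n × Fin ℓ) → Type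
  | none => Fin n → Fin m
  | some _ => Fin m → Bool

/-- The composed search problem as a `(1 + n * ℓ)`-partite search problem. -/
def partite {n ℓ m : ℕ} {O : Type*} (S : SearchProblem (LiftedInput n ℓ m) O) :
    SearchProblem (∀ p, Part n ℓ m p) O :=
  fun w => S (w none, fun i j => w (some (i, j)))

end BlockLift

open BlockLift

/-! The comparisons between models are inclusions of function classes. A conjunction is a threshold
function. A linear form is a sum with one term per part, so sorting each part by its term makes a
threshold set a simplex. `Dag.exists_lift` simulates a decision-dag for `S`: a vertex remembers the
pointers of its blocks, queries bit by bit those of its children's blocks, then moves on.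

For the lower bound, put `q = n * ℓ` and take a simplex-dag of size `s < q ^ (w + 1)`. Going up from
the leaves, each vertex discards a few pointer tuples (`unspread`) and rows (`rigid`), judged
relative to what lower ranks discarded. Both families are small because a total order gives each a
least element, above which all the others lie: many unspread tuples would contain a dense piece that
spreads above its least element (`card_unspread_lt`), and rigid rows lie in one small subcube
(`card_rigid_le`).

By upward closure, a feasible `(x, y)` with no discarded component can be raised to one `x'` and to
rows that realise every gadget output agreeing with the current one on a set `I` of at most `w`
blocks (`exists_spread_blocks`). This is the invariant of a walk down the dag. The sets for the two
children depend on `x` alone, so their blocks can be queried before the realising matrices are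
chosen. Those matrices determine a child to follow, and other blocks can then be forgotten. At most
three sets of `w` blocks are held at once, so `bw S ≤ 3 * w`. -/

namespace BlockLift

/-! ### Dags: ranks, transport and least size -/

section Dags

variable {I O L : Type*} {feas : L → Set I} {S : SearchProblem I O}

/-- The edge relation of a dag. -/
def Dag.Edge (P : Dag feas S) (a b : Fin P.size) : Prop :=
  ∃ u u', P.child a = some (u, u') ∧ (b = u ∨ b = u')

/-- The rank is the number of proper descendants. It drops along an edge because, by acyclicity, the
child is not its own descendant. -/
theorem Dag.exists_rank (P : Dag feas S) :
    ∃ rank : Fin P.size → ℕ, ∀ v u u', P.child v = some (u, u') →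
      rank u < rank v ∧ rank u' < rank v := by
  classical
  have key : ∀ a b, P.Edge a b →
      (Finset.univ.filter fun c => Relation.TransGen P.Edge b c).card <
        (Finset.univ.filter fun c => Relation.TransGen P.Edge a c).card := by
    intro a b hab
    refine Finset.card_lt_card ((Finset.ssubset_iff_of_subset ?_).2 ⟨b, ?_, ?_⟩)
    · intro c hc
      simp only [Finset.mem_filter, Finset.mem_univ, true_and] at hc ⊢
      exact Relation.TransGen.head hab hc
    · simpa using Relation.TransGen.single hab
    · simp only [Finset.mem_filter, Finset.mem_univ, true_and]
      exact P.acyclic b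
  exact ⟨fun a => (Finset.univ.filter fun c => Relation.TransGen P.Edge a c).card,
    fun v u u' h => ⟨key v u ⟨u, u', h, Or.inl rfl⟩, key v u' ⟨u, u', h, Or.inr rfl⟩⟩⟩

/-- A dag on an arbitrary finite type of vertices, whose acyclicity is witnessed by a rank. -/
theorem Dag.exists_of_rank {V : Type*} [Fintype V] (child : V → Option (V × V)) (label : V → L)
    (root : V) (rank : V → ℕ)
    (hrank : ∀ v u u', child v = some (u, u') → rank u < rank v ∧ rank u' < rank v)
    (hsource : ∀ v u u', child v = some (u, u') → u ≠ root ∧ u' ≠ root)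
    (hfull : feas (label root) = Set.univ)
    (hnonleaf : ∀ v u u', child v = some (u, u') →
      feas (label v) ⊆ feas (label u) ∪ feas (label u'))
    (hleaf : ∀ v, child v = none → ∃ o, ∀ x ∈ feas (label v), S x o) :
    ∃ P : Dag feas S, P.size = Fintype.card V ∧ ∀ i, ∃ v, P.label i = label v := by
  classical
  let e := Fintype.equivFin V
  have hchild : ∀ a u u', (child (e.symm a)).map (Prod.map e e) = some (u, u') →
      child (e.symm a) = some (e.symm u, e.symm u') := by
    intro a u u' h
    obtain ⟨⟨w, w'⟩, hw, hw'⟩ := Option.map_eq_some_iff.1 h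
    simp only [Prod.map_apply, Prod.mk.injEq] at hw'
    rw [hw, ← hw'.1, ← hw'.2]
    simp
  refine ⟨{ size := Fintype.card V
            child := fun a => (child (e.symm a)).map (Prod.map e e)
            label := fun a => label (e.symm a)
            root := e root
            acyclic := ?_
            root_source := ?_
            root_full := by simpa using hfull
            nonleaf := fun v u u' h => hnonleaf _ _ _ (hchild v u u' h)
            leaf := fun v h => hleaf _ (by simpa using h) }, rfl, fun i => ⟨_, rfl⟩⟩
  · intro v hv
    have : ∀ a b, Relation.TransGen (fun a b => ∃ u u',
        (child (e.symm a)).map (Prod.map e e) = some (u, u') ∧ (b = u ∨ b = u')) a b →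
        rank (e.symm b) < rank (e.symm a) := by
      have step : ∀ a b, (∃ u u',
          (child (e.symm a)).map (Prod.map e e) = some (u, u') ∧ (b = u ∨ b = u')) →
          rank (e.symm b) < rank (e.symm a) := by
        rintro a b ⟨u, u', h, rfl | rfl⟩
        · exact (hrank _ _ _ (hchild _ _ _ h)).1
        · exact (hrank _ _ _ (hchild _ _ _ h)).2
      intro a b hab
      induction hab with
      | single h => exact step _ _ h
      | tail _ h ih => exact (step _ _ h).trans ih
    exact lt_irrefl _ (this v v hv)
  · intro v u u' h
    have := hsource _ _ _ (hchild v u u' h)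
    exact ⟨fun hu => this.1 (by simp [hu]), fun hu => this.2 (by simp [hu])⟩

/-- Transport of a dag along a map of inputs. -/
theorem Dag.exists_comap {I' L' : Type*} {feas' : L' → Set I'} {S' : SearchProblem I' O}
    (g : I' → I) (hfeas : ∀ a, ∃ a', feas' a' = g ⁻¹' feas a) (hS : ∀ w o, S (g w) o → S' w o)
    (P : Dag feas S) : ∃ P' : Dag feas' S', P'.size = P.size := by
  choose φ hφ using hfeas
  refine ⟨{ size := P.size
            child := P.child
            label := fun v => φ (P.label v)
            root := P.root
            acyclic := P.acyclic
            root_source := P.root_source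
            root_full := by rw [hφ, P.root_full]; rfl
            nonleaf := fun v u u' h => ?_
            leaf := fun v h => ?_ }, rfl⟩
  · rw [hφ, hφ, hφ]
    exact fun w hw => P.nonleaf v u u' h hw
  · obtain ⟨o, ho⟩ := P.leaf v h
    refine ⟨o, fun w hw => hS w o (ho _ ?_)⟩
    rwa [hφ] at hw

theorem leastSize_le (P : Dag feas S) : leastSize feas S ≤ P.size := Nat.sInf_le ⟨P, rfl⟩

theorem exists_dag_leastSize (h : Nonempty (Dag feas S)) :
    ∃ P : Dag feas S, P.size = leastSize feas S :=
  Nat.sInf_mem (s := {s | ∃ P : Dag feas S, P.size = s}) ⟨_, h.some, rfl⟩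

theorem Dag.size_pos (P : Dag feas S) : 0 < P.size := P.root.pos

theorem leastSize_pos (h : Nonempty (Dag feas S)) : 0 < leastSize feas S := by
  obtain ⟨P, hP⟩ := exists_dag_leastSize h
  exact hP ▸ P.size_pos

theorem leastSize_comap_le {I' L' : Type*} {feas' : L' → Set I'} {S' : SearchProblem I' O}
    (g : I' → I) (hfeas : ∀ a, ∃ a', feas' a' = g ⁻¹' feas a) (hS : ∀ w o, S (g w) o → S' w o)
    (h : Nonempty (Dag feas S)) :
    Nonempty (Dag feas' S') ∧ leastSize feas' S' ≤ leastSize feas S := by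
  obtain ⟨P, hP⟩ := exists_dag_leastSize h
  obtain ⟨P', hP'⟩ := P.exists_comap g hfeas hS
  exact ⟨⟨P'⟩, (leastSize_le P').trans (hP'.trans hP).le⟩

end Dags

/-! ### Conjunctions, threshold functions and simplices -/

section Comparison

/-- A conjunction of literals is a linear threshold function. -/
theorem Conj.exists_ltf {I V : Type*} [Fintype V] (bit : V → I → Bool) (C : Conj V) :
    ∃ a : LTF V, LTF.feas bit a = Conj.feas bit C := by
  classical
  -- The threshold is the sum over the literals of the largest value that each can contribute, so it
  -- is reached exactly when every literal holds. This also covers contradictory conjunctions.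
  refine ⟨(fun v => ∑ p ∈ C with p.1 = v, if p.2 then 1 else -1,
    ∑ p ∈ C, if p.2 then 1 else 0), ?_⟩
  ext x
  have hsum : ∑ v, (∑ p ∈ C with p.1 = v, if p.2 then (1 : ℝ) else -1) *
      (if bit v x then 1 else 0) =
      ∑ p ∈ C, (if p.2 then (1 : ℝ) else -1) * (if bit p.1 x then 1 else 0) := by
    rw [← Finset.sum_fiberwise C Prod.fst]
    refine Finset.sum_congr rfl fun v _ => ?_
    rw [Finset.sum_mul]
    refine Finset.sum_congr rfl fun p hp => ?_
    rw [(Finset.mem_filter.1 hp).2]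
  have hle : ∀ p ∈ C, (if p.2 then (1 : ℝ) else -1) * (if bit p.1 x then 1 else 0) ≤
      if p.2 then 1 else 0 := by
    intro p _
    cases p.2 <;> cases bit p.1 x <;> simp
  simp only [LTF.feas, Conj.feas, Set.mem_ofPred_eq]
  rw [hsum]
  constructor
  · intro h p hp
    have := (Finset.sum_eq_sum_iff_of_le hle).1 (le_antisymm (Finset.sum_le_sum hle) h) p hp
    revert this
    cases p.2 <;> cases bit p.1 x <;> simp
  · intro h
    refine Finset.sum_le_sum fun p hp => ?_
    rw [h p hp]
    cases p.2 <;> simp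

theorem exists_linearOrder_of_weight {D : Type*} [Finite D] (f : D → ℝ) :
    ∃ o : LinearOrder D, ∀ x y, o.le x y → f x ≤ f y := by
  obtain ⟨k, ⟨e⟩⟩ := Finite.exists_equiv_fin D
  -- The enumeration `e` only breaks ties of `f`.
  refine ⟨LinearOrder.lift' (fun x => toLex (f x, e x)) ?_, ?_⟩
  · intro x y h
    exact e.injective (Prod.ext_iff.1 (toLex.injective h)).2
  · intro x y h
    have h' : toLex (f x, e x) ≤ toLex (f y, e y) := h
    rcases Prod.Lex.toLex_le_toLex.1 h' with h | h
    · exact le_of_lt h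
    · exact le_of_eq h.1

instance {n ℓ m : ℕ} (p : Option (Fin n × Fin ℓ)) : Finite (Part n ℓ m p) := by
  cases p
  · exact inferInstanceAs (Finite (Fin n → Fin m))
  · exact inferInstanceAs (Finite (Fin m → Bool))

/-- The inputs of all players, put together. -/
def joinParts {n ℓ m : ℕ} (w : ∀ p, Part n ℓ m p) : LiftedInput n ℓ m :=
  (w none, fun i j => w (some (i, j)))

/-- The contribution of one player to a linear form. -/
noncomputable def partWeight {n ℓ m : ℕ} (a : LiftedVar n ℓ m → ℝ) :
    ∀ p, Part n ℓ m p → ℝ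
  | none => fun x : Fin n → Fin m =>
      ∑ v : Fin n × Fin (Nat.clog 2 m), a (Sum.inl v) * (if (x v.1 : ℕ).testBit v.2 then 1 else 0)
  | some (i, j) => fun y : Fin m → Bool => ∑ c, a (Sum.inr (i, j, c)) * (if y c then 1 else 0)

theorem sum_liftedBit {n ℓ m : ℕ} (a : LiftedVar n ℓ m → ℝ) (w : ∀ p, Part n ℓ m p) :
    ∑ v, a v * (if liftedBit v (joinParts w) then 1 else 0) = ∑ p, partWeight a p (w p) := by
  rw [Fintype.sum_sum_type, Fintype.sum_option]
  congr 1
  rw [Fintype.sum_prod_type, Fintype.sum_prod_type]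
  refine Finset.sum_congr rfl fun i _ => ?_
  rw [Fintype.sum_prod_type]
  rfl

theorem LTF.exists_simplex {n ℓ m : ℕ} (a : LTF (LiftedVar n ℓ m)) :
    ∃ A : {A : Set (∀ p, Part n ℓ m p) // IsSimplex A},
      simplexFeas A = joinParts ⁻¹' LTF.feas liftedBit a := by
  choose ord hord using fun p => exists_linearOrder_of_weight (partWeight (ℓ := ℓ) a.1 p)
  refine ⟨⟨joinParts ⁻¹' LTF.feas liftedBit a, ord, fun x y hxy hx => ?_⟩, rfl⟩
  simp only [LTF.feas, Set.mem_preimage, Set.mem_ofPred_eq, sum_liftedBit] at hx ⊢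
  exact hx.trans (Finset.sum_le_sum fun p _ => hord p _ _ (hxy p))

theorem ltfDag_le_decDag {I O V : Type*} [Fintype V] {bit : V → I → Bool} {S : SearchProblem I O}
    (h : Nonempty (DecisionDag bit S)) : Nonempty (LTFDag bit S) ∧ ltfDag bit S ≤ decDag bit S :=
  leastSize_comap_le id (Conj.exists_ltf bit) (fun _ _ => id) h

theorem simDag_le_ltfDag {n ℓ m : ℕ} {O : Type*} {S : SearchProblem (LiftedInput n ℓ m) O}
    (h : Nonempty (LTFDag liftedBit S)) :
    Nonempty (SimplexDag (partite S)) ∧ simDag (partite S) ≤ ltfDag liftedBit S :=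
  leastSize_comap_le joinParts LTF.exists_simplex (fun _ _ => id) h

end Comparison

end BlockLift

namespace BlockLift

/-! ### Block-width through trees of conjunctions -/

section Width

variable {n ℓ : ℕ} {O : Type*}

/-- The blocks that a conjunction touches. -/
def Conj.blocks (C : Conj (Fin n × Fin ℓ)) : Finset (Fin n) := C.image fun p => p.1.1

theorem Conj.mem_blocks {C : Conj (Fin n × Fin ℓ)} {p : (Fin n × Fin ℓ) × Bool} (h : p ∈ C) :
    p.1.1 ∈ C.blocks := Finset.mem_image_of_mem (fun p => p.1.1) h

/-- The conjunction that fixes the blocks in `I` to their values in `z`. -/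
def blockConj (I : Finset (Fin n)) (z : BlockInput n ℓ) : Conj (Fin n × Fin ℓ) :=
  (I ×ˢ Finset.univ).image fun v => (v, z v.1 v.2)

theorem mem_feas_blockConj {I : Finset (Fin n)} {z z' : BlockInput n ℓ} :
    z' ∈ Conj.feas blockBit (blockConj I z) ↔ ∀ i ∈ I, z' i = z i := by
  simp only [Conj.feas, blockConj, blockBit, Set.mem_ofPred_eq, Finset.mem_image,
    Finset.mem_product, Finset.mem_univ, and_true]
  constructor
  · intro h i hi
    funext j
    exact h ((i, j), z i j) ⟨(i, j), hi, rfl⟩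
  · rintro h _ ⟨v, hv, rfl⟩
    exact congrFun (h v.1 hv) v.2

theorem blocks_blockConj_subset (I : Finset (Fin n)) (z : BlockInput n ℓ) :
    (blockConj I z).blocks ⊆ I := by
  intro i
  simp only [Conj.blocks, blockConj, Finset.mem_image, Finset.mem_product, Finset.mem_univ,
    and_true]
  rintro ⟨_, ⟨v, hv, rfl⟩, rfl⟩
  exact hv

theorem Conj.blockWidth_le_of_subset {C : Conj (Fin n × Fin ℓ)} {J : Finset (Fin n)}
    (h : C.blocks ⊆ J) : C.blockWidth ≤ J.card := Finset.card_le_card h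

/-- `S`, restricted to `C`, is solved by a tree of depth `k` and of block-width at most `W`. -/
def SolvedIn (S : SearchProblem (BlockInput n ℓ) O) (W : ℕ) : ℕ → Conj (Fin n × Fin ℓ) → Prop
  | 0, C => C.blockWidth ≤ W ∧ ∃ o, ∀ z ∈ Conj.feas blockBit C, S z o
  | k + 1, C => C.blockWidth ≤ W ∧ ∃ C₁ C₂,
      Conj.feas blockBit C ⊆ Conj.feas blockBit C₁ ∪ Conj.feas blockBit C₂ ∧
        SolvedIn S W k C₁ ∧ SolvedIn S W k C₂

/-- `S`, restricted to `C`, is solved by a tree of block-width at most `W`. -/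
def Solved (S : SearchProblem (BlockInput n ℓ) O) (W : ℕ) (C : Conj (Fin n × Fin ℓ)) : Prop :=
  ∃ k, SolvedIn S W k C

variable {S : SearchProblem (BlockInput n ℓ) O} {W : ℕ}

theorem SolvedIn.blockWidth_le {k : ℕ} {C : Conj (Fin n × Fin ℓ)} (h : SolvedIn S W k C) :
    C.blockWidth ≤ W := by
  cases k <;> exact h.1

theorem SolvedIn.mono {k k' : ℕ} {C : Conj (Fin n × Fin ℓ)} (hk : k ≤ k')
    (h : SolvedIn S W k C) : SolvedIn S W k' C := by
  induction hk with
  | refl => exact h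
  -- Trees are padded by a vertex whose two children carry its own conjunction.
  | step _ ih => exact ⟨h.blockWidth_le, C, C, Set.subset_union_left, ih, ih⟩

theorem Solved.of_leaf {C : Conj (Fin n × Fin ℓ)} (hC : C.blockWidth ≤ W)
    (h : ∃ o, ∀ z ∈ Conj.feas blockBit C, S z o) : Solved S W C := ⟨0, hC, h⟩

theorem Solved.of_subset_union {C C₁ C₂ : Conj (Fin n × Fin ℓ)} (hC : C.blockWidth ≤ W)
    (h : Conj.feas blockBit C ⊆ Conj.feas blockBit C₁ ∪ Conj.feas blockBit C₂)
    (h₁ : Solved S W C₁) (h₂ : Solved S W C₂) : Solved S W C := by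
  obtain ⟨k₁, h₁⟩ := h₁
  obtain ⟨k₂, h₂⟩ := h₂
  exact ⟨max k₁ k₂ + 1, hC, C₁, C₂, h, h₁.mono (le_max_left _ _), h₂.mono (le_max_right _ _)⟩

/-- Querying the variables in `R` one after the other. -/
theorem Solved.of_query_vars {J : Finset (Fin n)} (hJ : J.card ≤ W)
    (R : Finset (Fin n × Fin ℓ)) (hR : ∀ v ∈ R, v.1 ∈ J) :
    ∀ C : Conj (Fin n × Fin ℓ), C.blocks ⊆ J →
      (∀ D : Conj (Fin n × Fin ℓ), C ⊆ D → D.blocks ⊆ J →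
        (∀ v ∈ R, ∃ b, (v, b) ∈ D) → Solved S W D) → Solved S W C := by
  induction R using Finset.induction_on with
  | empty => exact fun C hC h => h C subset_rfl hC (by simp)
  | insert v R hv ih =>
    intro C hC h
    have key : ∀ b, Solved S W (insert (v, b) C) := by
      intro b
      refine ih (fun u hu => hR u (Finset.mem_insert_of_mem hu)) _ ?_ ?_
      · rw [Conj.blocks, Finset.image_insert]
        exact Finset.insert_subset (hR v (Finset.mem_insert_self _ _)) hC
      · intro D hD hDJ hDR
        refine h D ((Finset.subset_insert _ _).trans hD) hDJ fun u hu => ?_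
        rcases Finset.mem_insert.1 hu with rfl | hu
        · exact ⟨b, hD (Finset.mem_insert_self _ _)⟩
        · exact hDR u hu
    refine Solved.of_subset_union ((Conj.blockWidth_le_of_subset hC).trans hJ) ?_
      (key true) (key false)
    intro z hz
    have hmem : z ∈ Conj.feas blockBit (insert (v, blockBit v z) C) := by
      intro p hp
      rcases Finset.mem_insert.1 hp with rfl | hp
      · rfl
      · exact hz p hp
    cases hb : blockBit v z
    · exact Or.inr (hb ▸ hmem)
    · exact Or.inl (hb ▸ hmem)

/-- Querying all the blocks in `J`. -/
theorem Solved.of_query_blocks (hS : TotalSearch S) {J : Finset (Fin n)} (hJ : J.card ≤ W)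
    {C : Conj (Fin n × Fin ℓ)} (hC : C.blocks ⊆ J)
    (h : ∀ z ∈ Conj.feas blockBit C, ∃ C', z ∈ Conj.feas blockBit C' ∧ C'.blocks ⊆ J ∧
      Solved S W C') : Solved S W C := by
  refine Solved.of_query_vars hJ (J ×ˢ Finset.univ) (fun v hv => (Finset.mem_product.1 hv).1)
    C hC fun D hCD hDJ hD => ?_
  have hDW := (Conj.blockWidth_le_of_subset hDJ).trans hJ
  -- `D` may contain a literal and its negation; any output then serves, and totality supplies one.
  -- Otherwise `D` fixes all variables of `J`, hence implies any `C'` on `J` that one of its points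
  -- satisfies.
  rcases (Conj.feas blockBit D).eq_empty_or_nonempty with hempty | ⟨z, hz⟩
  · obtain ⟨o, -⟩ := hS fun _ _ => false
    exact Solved.of_leaf hDW ⟨o, by simp [hempty]⟩
  · obtain ⟨C', hzC', hC'J, hC'⟩ := h z fun p hp => hz p (hCD hp)
    refine Solved.of_subset_union hDW ?_ hC' hC'
    intro z' hz'
    refine Or.inl fun p hp => ?_
    obtain ⟨b, hb⟩ := hD p.1 (Finset.mem_product.2 ⟨hC'J (Conj.mem_blocks hp), Finset.mem_univ _⟩)
    rw [hz' _ hb, ← hzC' p hp, hz _ hb]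

/-- Size is irrelevant for width, so all solved conjunctions can be arranged in layers by depth.
Edges go down one layer, and the root lies in the top one, hence has no incoming edge. -/
theorem Solved.exists_dag (h : Solved S W ∅) :
    ∃ P : DecisionDag blockBit S, blockWidth P ≤ W := by
  classical
  obtain ⟨N, hN⟩ := h
  let V := (k : Fin (N + 1)) × {C : Conj (Fin n × Fin ℓ) // SolvedIn S W k C}
  have hstep : ∀ k : ℕ, ∀ C, SolvedIn S W (k + 1) C → ∃ C₁ C₂,
      Conj.feas blockBit C ⊆ Conj.feas blockBit C₁ ∪ Conj.feas blockBit C₂ ∧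
        SolvedIn S W k C₁ ∧ SolvedIn S W k C₂ := fun k C h => h.2
  choose! f g hfg using hstep
  let child : V → Option (V × V) := fun
    | ⟨⟨0, _⟩, _⟩ => none
    | ⟨⟨k + 1, hk⟩, C, hC⟩ => some (⟨⟨k, by omega⟩, f k C, (hfg k C hC).2.1⟩,
        ⟨⟨k, by omega⟩, g k C, (hfg k C hC).2.2⟩)
  have hdag : ∃ P : DecisionDag blockBit S, P.size = Fintype.card V ∧
      ∀ i, ∃ v : V, P.label i = v.2.1 := by
    refine Dag.exists_of_rank child (fun v => v.2.1) ⟨Fin.last N, ∅, hN⟩ (fun v => v.1)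
      ?_ ?_ ?_ ?_ ?_
    · rintro ⟨⟨_ | k, hk⟩, C, hC⟩ u u' h
      · cases h
      · simp only [child, Option.some.injEq, Prod.mk.injEq] at h
        rw [← h.1, ← h.2]
        simp
    · rintro ⟨⟨_ | k, hk⟩, C, hC⟩ u u' h
      · cases h
      · simp only [child, Option.some.injEq, Prod.mk.injEq] at h
        rw [← h.1, ← h.2]
        constructor <;>
        · intro h
          have := congrArg (fun v : V => (v.1 : ℕ)) h
          simp at this
          omega
    · simp [Conj.feas]
    · rintro ⟨⟨_ | k, hk⟩, C, hC⟩ u u' h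
      · cases h
      · simp only [child, Option.some.injEq, Prod.mk.injEq] at h
        rw [← h.1, ← h.2]
        exact (hfg k C hC).1
    · rintro ⟨⟨_ | k, hk⟩, C, hC⟩ h
      · exact hC.2
      · cases h
  obtain ⟨P, -, hP⟩ := hdag
  refine ⟨P, Finset.sup_le fun i _ => ?_⟩
  obtain ⟨v, hv⟩ := hP i
  rw [hv]
  exact v.2.2.blockWidth_le

theorem bw_le_blockWidth (P : DecisionDag blockBit S) : bw S ≤ blockWidth P :=
  Nat.sInf_le ⟨P, rfl⟩

theorem bw_le_of_solved (h : Solved S W ∅) : bw S ≤ W := by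
  obtain ⟨P, hP⟩ := h.exists_dag
  exact (bw_le_blockWidth P).trans hP

theorem solved_all_blocks (hS : TotalSearch S) : Solved S n ∅ := by
  refine Solved.of_query_blocks hS (J := Finset.univ) (by simp) (Finset.subset_univ _)
    fun z _ => ⟨blockConj Finset.univ z, by simp [mem_feas_blockConj], Finset.subset_univ _, ?_⟩
  obtain ⟨o, ho⟩ := hS z
  refine Solved.of_leaf ?_ ⟨o, fun z' hz' => ?_⟩
  · simpa using Conj.blockWidth_le_of_subset (blocks_blockConj_subset Finset.univ z)
  · have : z' = z := funext fun i => mem_feas_blockConj.1 hz' i (Finset.mem_univ i)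
    rwa [this]

end Width

end BlockLift

namespace BlockLift

/-! ### Lifting a decision-dag through the gadget -/

section UpperBound

open Finset

variable {n ℓ m : ℕ} {O : Type*}

theorem eq_of_testBit_clog {a b : Fin m}
    (h : ∀ r : Fin (Nat.clog 2 m), (a : ℕ).testBit r = (b : ℕ).testBit r) : a = b := by
  refine Fin.ext (Nat.eq_of_testBit_eq fun r => ?_)
  by_cases hr : r < Nat.clog 2 m
  · exact h ⟨r, hr⟩
  · have hm : m ≤ 2 ^ r := (Nat.le_pow_clog (by norm_num) m).trans
      (Nat.pow_le_pow_right (by norm_num) (not_lt.1 hr))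
    rw [Nat.testBit_lt_two_pow (a.2.trans_le hm), Nat.testBit_lt_two_pow (b.2.trans_le hm)]

/-- The conjunction that fixes the pointer bits in `R` to their values in `x`, and that requires
`C` of the columns selected by `x`. -/
def liftConj (R : Finset (Fin n × Fin (Nat.clog 2 m))) (C : Conj (Fin n × Fin ℓ))
    (x : Fin n → Fin m) : Conj (LiftedVar n ℓ m) :=
  (R.image fun u => (Sum.inl u, (x u.1 : ℕ).testBit u.2)) ∪
    C.image fun p => (Sum.inr (p.1.1, p.1.2, x p.1.1), p.2)

theorem mem_feas_liftConj {R : Finset (Fin n × Fin (Nat.clog 2 m))} {C : Conj (Fin n × Fin ℓ)}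
    {x : Fin n → Fin m} {w : LiftedInput n ℓ m} :
    w ∈ Conj.feas liftedBit (liftConj R C x) ↔
      (∀ u ∈ R, (w.1 u.1 : ℕ).testBit u.2 = (x u.1 : ℕ).testBit u.2) ∧
        ∀ p ∈ C, w.2 p.1.1 p.1.2 (x p.1.1) = p.2 := by
  simp only [Conj.feas, liftConj, Set.mem_ofPred_eq, mem_union, mem_image]
  constructor
  · exact fun h => ⟨fun u hu => h _ (Or.inl ⟨u, hu, rfl⟩), fun p hp => h _ (Or.inr ⟨p, hp, rfl⟩)⟩
  · rintro ⟨h₁, h₂⟩ _ (⟨u, hu, rfl⟩ | ⟨p, hp, rfl⟩)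
    · exact h₁ u hu
    · exact h₂ p hp

/-- The gadget output of `w`. -/
abbrev gadgetOutput (w : LiftedInput n ℓ m) : BlockInput n ℓ := fun i => colIndex (w.1 i) (w.2 i)

theorem pointer_eq {R : Finset (Fin n × Fin (Nat.clog 2 m))} {x : Fin n → Fin m}
    {w : LiftedInput n ℓ m}
    (h : ∀ u ∈ R, (w.1 u.1 : ℕ).testBit u.2 = (x u.1 : ℕ).testBit u.2) {i : Fin n}
    (hi : ∀ r, (i, r) ∈ R) : w.1 i = x i :=
  eq_of_testBit_clog fun r => h (i, r) (hi r)

theorem feas_blockBit_eq_univ {C : Conj (Fin n × Fin ℓ)}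
    (h : Conj.feas blockBit C = Set.univ) : C = ∅ := by
  refine eq_empty_of_forall_notMem fun p hp => ?_
  have : (fun _ _ => !p.2) ∈ Conj.feas blockBit C := h ▸ Set.mem_univ _
  have := this p hp
  simp [blockBit] at this

variable {S : SearchProblem (BlockInput n ℓ) O}

/-- The blocks that matter at a vertex: its own and those of its children. -/
def Dag.nearBlocks (P : DecisionDag blockBit S) (v : Fin P.size) : Finset (Fin n) :=
  (P.label v).blocks ∪ match P.child v with
    | none => ∅
    | some (u, u') => (P.label u).blocks ∪ (P.label u').blocks

theorem Dag.blocks_subset_nearBlocks (P : DecisionDag blockBit S) (v : Fin P.size) :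
    (P.label v).blocks ⊆ P.nearBlocks v := subset_union_left

theorem Dag.card_nearBlocks_le (P : DecisionDag blockBit S) (v : Fin P.size) :
    #(P.nearBlocks v) ≤ 3 * blockWidth P := by
  have h : ∀ v, #(P.label v).blocks ≤ blockWidth P := fun v =>
    le_sup (f := fun v => (P.label v).blockWidth) (mem_univ v)
  have hv := h v
  refine (card_union_le _ _).trans ?_
  cases hc : P.child v with
  | none => simp; omega
  | some c =>
    have h₁ := h c.1
    have h₂ := h c.2
    have := card_union_le (P.label c.1).blocks (P.label c.2).blocks
    simp only
    omega

theorem card_masked [NeZero m] (B : Finset (Fin n)) :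
    Fintype.card {x : Fin n → Fin m // ∀ i ∉ B, x i = 0} = m ^ #B := by
  have h : ∀ x : Fin n → Fin m, x ∈ (Fintype.piFinset fun i => if i ∈ B then univ else {0}) ↔
      ∀ i ∉ B, x i = 0 := by
    intro x
    simp only [Fintype.mem_piFinset]
    refine forall_congr' fun i => ?_
    by_cases hi : i ∈ B <;> simp [hi]
  rw [Fintype.card_of_subtype _ h, Fintype.card_piFinset]
  calc _ = ∏ i, if i ∈ B then m else 1 := by
        refine prod_congr rfl fun i _ => ?_
        by_cases hi : i ∈ B <;> simp [hi]
    _ = m ^ #B := by rw [prod_ite_mem, univ_inter, prod_const]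

/-- The pointers `x`, with those outside `B` set to `0`. -/
def mask [NeZero m] (B : Finset (Fin n)) (x : Fin n → Fin m) :
    {x : Fin n → Fin m // ∀ i ∉ B, x i = 0} :=
  ⟨fun i => if i ∈ B then x i else 0, fun i hi => by simp [hi]⟩

theorem mask_apply [NeZero m] {B : Finset (Fin n)} (x : Fin n → Fin m) {i : Fin n} (hi : i ∈ B) :
    (mask B x).1 i = x i := by simp [mask, hi]

/-- The new vertices are triples of a vertex of `P`, a counter of pointer bits queried so far, and a
guess of the nearby pointers. Pointers of the vertex's own blocks are known throughout. Masking the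
guess outside the nearby blocks keeps the number of guesses at `m ^ (3 * blockWidth P)`. -/
theorem Dag.exists_lift [NeZero m] (P : DecisionDag blockBit S) :
    ∃ P' : DecisionDag liftedBit (compInd S m), P'.size ≤
      P.size * ((3 * blockWidth P * Nat.clog 2 m + 1) * m ^ (3 * blockWidth P)) := by
  classical
  obtain ⟨rank, hrank⟩ := P.exists_rank
  set D := 3 * blockWidth P * Nat.clog 2 m
  let V := (v : Fin P.size) × (Fin (D + 1) × {x : Fin n → Fin m // ∀ i ∉ P.nearBlocks v, x i = 0})
  let own : Fin P.size → Finset (Fin n × Fin (Nat.clog 2 m)) := fun v =>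
    (P.label v).blocks ×ˢ univ
  let bits : Fin P.size → List (Fin n × Fin (Nat.clog 2 m)) := fun v =>
    (P.nearBlocks v ×ˢ univ).toList
  let known : Fin P.size → ℕ → Finset (Fin n × Fin (Nat.clog 2 m)) := fun v t =>
    own v ∪ ((bits v).take t).toFinset
  have hbits : ∀ v, (bits v).length ≤ D := by
    intro v
    simp only [bits, length_toList, card_product, card_univ, Fintype.card_fin]
    exact Nat.mul_le_mul_right _ (P.card_nearBlocks_le v)
  have hown : ∀ v i, i ∈ (P.label v).blocks → ∀ t r, (i, r) ∈ known v t := fun v i hi t r =>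
    mem_union_left _ (mem_product.2 ⟨hi, mem_univ _⟩)
  have hnear : ∀ v i, i ∈ P.nearBlocks v → ∀ t, D ≤ t → ∀ r, (i, r) ∈ known v t := by
    intro v i hi t ht r
    refine mem_union_right _ ?_
    rw [List.take_of_length_le ((hbits v).trans ht), toList_toFinset]
    exact mem_product.2 ⟨hi, mem_univ _⟩
  have hknown0 : ∀ v i r, (i, r) ∈ known v 0 → i ∈ (P.label v).blocks := by
    intro v i r h
    simpa [known, own] using h
  have hknown_near : ∀ v t, ∀ r ∈ known v t, r.1 ∈ P.nearBlocks v := by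
    intro v t r hr
    rcases mem_union.1 hr with hr | hr
    · exact mem_union_left _ (mem_product.1 hr).1
    · exact (mem_product.1 (mem_toList.1 (List.mem_of_mem_take (List.mem_toFinset.1 hr)))).1
  have hknown_succ : ∀ v t, ∀ u ∈ known v (t + 1), u ∉ known v t →
      ∀ r ∈ known v (t + 1), r = u ∨ r ∈ known v t := by
    intro v t u hu hu' r hr
    simp only [known, mem_union, List.mem_toFinset, List.take_add_one, List.mem_append,
      Option.mem_toList, not_or] at hu hu' hr ⊢
    grind
  have hgadget : ∀ (v : Fin P.size) (t : ℕ) (x : Fin n → Fin m) (w : LiftedInput n ℓ m),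
      w ∈ Conj.feas liftedBit (liftConj (known v t) (P.label v) x) →
      gadgetOutput w ∈ Conj.feas blockBit (P.label v) := by
    intro v t x w hw p hp
    obtain ⟨h₁, h₂⟩ := mem_feas_liftConj.1 hw
    rw [← h₂ p hp, ← pointer_eq h₁ (hown v _ (Conj.mem_blocks hp) t)]
    rfl
  have hquery : ∀ (v : Fin P.size) (t : ℕ)
      (x : {x : Fin n → Fin m // ∀ i ∉ P.nearBlocks v, x i = 0}),
      ∃ x' : {x : Fin n → Fin m // ∀ i ∉ P.nearBlocks v, x i = 0},
      Conj.feas liftedBit (liftConj (known v t) (P.label v) x.1) ⊆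
        Conj.feas liftedBit (liftConj (known v (t + 1)) (P.label v) x.1) ∪
        Conj.feas liftedBit (liftConj (known v (t + 1)) (P.label v) x'.1) := by
    intro v t x
    -- Flipping a bit of `x` may leave the range of `Fin m` when `m` is not a power of two. So the
    -- other branch takes its pointers from an actual input with the other bit; if there is none,
    -- the query has one outcome.
    by_cases hw : ∃ w ∈ Conj.feas liftedBit (liftConj (known v t) (P.label v) x.1),
        w ∉ Conj.feas liftedBit (liftConj (known v (t + 1)) (P.label v) x.1)
    · obtain ⟨w, hw, hw'⟩ := hw
      obtain ⟨h₁, h₂⟩ := mem_feas_liftConj.1 hw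
      obtain ⟨u, hu, huw⟩ : ∃ u ∈ known v (t + 1),
          (w.1 u.1 : ℕ).testBit u.2 ≠ (x.1 u.1 : ℕ).testBit u.2 := by
        by_contra! h
        exact hw' (mem_feas_liftConj.2 ⟨h, h₂⟩)
      have hsucc := hknown_succ v t u hu fun h => huw (h₁ u h)
      refine ⟨mask _ w.1, fun w₂ hw₂ => ?_⟩
      obtain ⟨h₃, h₄⟩ := mem_feas_liftConj.1 hw₂
      by_cases hu₂ : (w₂.1 u.1 : ℕ).testBit u.2 = (x.1 u.1 : ℕ).testBit u.2
      · refine Or.inl (mem_feas_liftConj.2 ⟨fun r hr => ?_, h₄⟩)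
        rcases hsucc r hr with rfl | hr
        · exact hu₂
        · exact h₃ r hr
      · refine Or.inr (mem_feas_liftConj.2 ⟨fun r hr => ?_, fun p hp => ?_⟩)
        · rw [mask_apply _ (hknown_near v _ r hr)]
          rcases hsucc r hr with rfl | hr
          · rw [Bool.eq_not_of_ne hu₂, Bool.eq_not_of_ne huw]
          · rw [h₃ r hr, h₁ r hr]
        · have hp' := Conj.mem_blocks hp
          rw [mask_apply _ (P.blocks_subset_nearBlocks v hp'), pointer_eq h₁ (hown v _ hp' t)]
          exact h₄ p hp
    · push Not at hw
      exact ⟨x, fun w h => Or.inl (hw w h)⟩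
  choose flip hflip using hquery
  let label : V → Conj (LiftedVar n ℓ m) := fun a =>
    liftConj (known a.1 a.2.1) (P.label a.1) a.2.2.1
  let next : (a : V) → (a.2.1 : ℕ) < D → _ → V := fun a h x =>
    ⟨a.1, ⟨a.2.1 + 1, by omega⟩, x⟩
  let enter : V → Fin P.size → V := fun a u => ⟨u, 0, mask _ a.2.2.1⟩
  let child : V → Option (V × V) := fun a => (P.child a.1).map fun c =>
    if h : (a.2.1 : ℕ) < D then (next a h a.2.2, next a h (flip a.1 a.2.1 a.2.2))
    else (enter a c.1, enter a c.2)
  have hchild : ∀ a b b', child a = some (b, b') → ∃ u u', P.child a.1 = some (u, u') ∧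
      ((∃ h : (a.2.1 : ℕ) < D, b = next a h a.2.2 ∧ b' = next a h (flip a.1 a.2.1 a.2.2)) ∨
        (D ≤ (a.2.1 : ℕ) ∧ b = enter a u ∧ b' = enter a u')) := by
    intro a b b' hab
    obtain ⟨⟨u, u'⟩, hc, hb⟩ := Option.map_eq_some_iff.1 hab
    refine ⟨u, u', hc, ?_⟩
    split_ifs at hb with h
    · exact Or.inl ⟨h, (Prod.ext_iff.1 hb).1.symm, (Prod.ext_iff.1 hb).2.symm⟩
    · exact Or.inr ⟨not_lt.1 h, (Prod.ext_iff.1 hb).1.symm, (Prod.ext_iff.1 hb).2.symm⟩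
  have hdag : ∃ P' : DecisionDag liftedBit (compInd S m), P'.size = Fintype.card V ∧
      ∀ i, ∃ a : V, P'.label i = label a := by
    -- The rank is lexicographic: the rank in `P`, then the number of queries left.
    refine Dag.exists_of_rank child label ⟨P.root, 0, mask _ 0⟩
      (fun a => rank a.1 * (D + 1) + (D - a.2.1)) ?_ ?_ ?_ ?_ ?_
    · intro a b b' hab
      obtain ⟨u, u', hc, ⟨h, rfl, rfl⟩ | ⟨h, rfl, rfl⟩⟩ := hchild a b b' hab
      · simp only [next]
        omega
      · have hr := hrank _ _ _ hc
        have h₁ := Nat.mul_le_mul_right (D + 1) (Nat.succ_le_of_lt hr.1)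
        have h₂ := Nat.mul_le_mul_right (D + 1) (Nat.succ_le_of_lt hr.2)
        rw [Nat.succ_mul] at h₁ h₂
        simp only [enter, Fin.val_zero]
        omega
    · intro a b b' hab
      obtain ⟨u, u', hc, ⟨h, rfl, rfl⟩ | ⟨h, rfl, rfl⟩⟩ := hchild a b b' hab
      · constructor <;>
        · intro h
          have := congrArg (fun a : V => (a.2.1 : ℕ)) h
          simp [next] at this
      · have hs := P.root_source _ _ _ hc
        exact ⟨fun h => hs.1 (congrArg Sigma.fst h), fun h => hs.2 (congrArg Sigma.fst h)⟩
    · have hroot := feas_blockBit_eq_univ P.root_full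
      refine Set.eq_univ_of_forall fun w => mem_feas_liftConj.2 ⟨fun u hu => ?_, fun p hp => ?_⟩
      · have := hknown0 _ _ _ hu
        simp [hroot, Conj.blocks] at this
      · simp [hroot] at hp
    · intro a b b' hab
      obtain ⟨u, u', hc, ⟨h, rfl, rfl⟩ | ⟨h, rfl, rfl⟩⟩ := hchild a b b' hab
      · exact hflip a.1 a.2.1 a.2.2
      · intro w hw
        obtain ⟨h₁, h₂⟩ := mem_feas_liftConj.1 hw
        have henter : ∀ u, (P.label u).blocks ⊆ P.nearBlocks a.1 →
            gadgetOutput w ∈ Conj.feas blockBit (P.label u) →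
            w ∈ Conj.feas liftedBit (label (enter a u)) := by
          intro u hu hz
          have heq : ∀ i ∈ (P.label u).blocks, w.1 i = (mask (P.nearBlocks u) a.2.2.1).1 i := by
            intro i hi
            rw [mask_apply _ (P.blocks_subset_nearBlocks u hi)]
            exact pointer_eq h₁ (hnear _ _ (hu hi) _ h)
          refine mem_feas_liftConj.2 ⟨fun r hr => ?_, fun p hp => ?_⟩
          · rw [heq _ (hknown0 _ _ _ hr)]
          · rw [← heq _ (Conj.mem_blocks hp)]
            exact hz p hp
        have hnb : P.nearBlocks a.1 =
            (P.label a.1).blocks ∪ ((P.label u).blocks ∪ (P.label u').blocks) := by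
          simp only [Dag.nearBlocks, hc]
        rcases P.nonleaf _ _ _ hc (hgadget _ _ _ _ hw) with hz | hz
        · exact Or.inl (henter u (hnb ▸ subset_union_left.trans subset_union_right) hz)
        · exact Or.inr (henter u' (hnb ▸ subset_union_right.trans subset_union_right) hz)
    · intro a ha
      obtain ⟨o, ho⟩ := P.leaf a.1 (Option.map_eq_none_iff.1 ha)
      exact ⟨o, fun w hw => ho _ (hgadget _ _ _ _ hw)⟩
  obtain ⟨P', hP', -⟩ := hdag
  refine ⟨P', hP'.trans_le ?_⟩
  simp only [V, Fintype.card_sigma, Fintype.card_prod, Fintype.card_fin, card_masked]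
  calc _ ≤ ∑ _v : Fin P.size, (D + 1) * m ^ (3 * blockWidth P) :=
        sum_le_sum fun v _ => Nat.mul_le_mul_left _
          (Nat.pow_le_pow_right (NeZero.pos m) (P.card_nearBlocks_le v))
    _ = _ := by simp

theorem blockWidth_eq_zero (h : n * ℓ = 0) (P : DecisionDag blockBit S) : blockWidth P = 0 := by
  refine Nat.le_zero.1 (Finset.sup_le fun v _ => ?_)
  have : P.label v = ∅ := by
    refine eq_empty_of_forall_notMem fun p _ => ?_
    have := Nat.mul_pos p.1.1.pos p.1.2.pos
    omega
  simp [this, Conj.blockWidth]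

theorem exists_liftedDag_of_no_variables (hS : TotalSearch S)
    (h : n * ℓ = 0) : ∃ P' : DecisionDag liftedBit (compInd S m), P'.size = 1 := by
  have hz : ∀ z : BlockInput n ℓ, z = fun _ _ => false := by
    intro z
    funext i j
    have := Nat.mul_pos i.pos j.pos
    omega
  obtain ⟨o, ho⟩ := hS fun _ _ => false
  obtain ⟨P', hP', -⟩ := Dag.exists_of_rank (feas := Conj.feas liftedBit)
    (S := compInd S m) (V := Unit) (fun _ => none) (fun _ => ∅) () (fun _ => 0) (by simp) (by simp)
    (by simp [Conj.feas]) (by simp) fun _ _ => ⟨o, fun w _ => by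
      change S _ o
      rw [hz fun i => colIndex (w.1 i) (w.2 i)]
      exact ho⟩
  exact ⟨P', by simpa using hP'⟩

/-- For `m > 1` the first factor is at most `2 ^ (3 * b * Nat.clog 2 m)`, and `2 ^ Nat.clog 2 m ≤ m
^ 2`: exponents `6 * b` and `3 * b` add up. -/
theorem query_overhead_le (hm : 0 < m) (b : ℕ) :
    (3 * b * Nat.clog 2 m + 1) * m ^ (3 * b) ≤ m ^ (9 * b) := by
  rcases Nat.lt_or_ge 1 m with h1 | h1
  · have hk : 2 ^ Nat.clog 2 m ≤ m ^ 2 := by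
      have h := Nat.pow_pred_clog_lt_self (b := 2) (by norm_num) h1
      have hpos := Nat.clog_pos (by norm_num : 1 < 2) h1
      calc 2 ^ Nat.clog 2 m = 2 ^ (Nat.clog 2 m).pred * 2 := by
            rw [← pow_succ, ← Nat.succ_eq_add_one, Nat.succ_pred_eq_of_pos hpos]
        _ ≤ m * m := Nat.mul_le_mul h.le h1
        _ = m ^ 2 := (sq m).symm
    calc (3 * b * Nat.clog 2 m + 1) * m ^ (3 * b)
        ≤ 2 ^ (3 * b * Nat.clog 2 m) * m ^ (3 * b) :=
          Nat.mul_le_mul_right _ Nat.lt_two_pow_self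
      _ = (2 ^ Nat.clog 2 m) ^ (3 * b) * m ^ (3 * b) := by rw [← pow_mul, mul_comm (3 * b)]
      _ ≤ (m ^ 2) ^ (3 * b) * m ^ (3 * b) :=
          Nat.mul_le_mul_right _ (Nat.pow_le_pow_left hk _)
      _ = m ^ (9 * b) := by rw [← pow_mul, ← pow_add]; congr 1; ring
  · obtain rfl : m = 1 := by omega
    simp

theorem exists_liftedDag (hm : m = (n * ℓ) ^ 5) (hS : TotalSearch S) (P : DecisionDag blockBit S) :
    ∃ P' : DecisionDag liftedBit (compInd S m), P'.size ≤ m ^ (9 * blockWidth P) * P.size := by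
  rcases Nat.eq_zero_or_pos (n * ℓ) with h | h
  · obtain ⟨P', hP'⟩ := exists_liftedDag_of_no_variables (m := m) hS h
    refine ⟨P', ?_⟩
    rw [hP', blockWidth_eq_zero h P]
    simpa using Nat.succ_le_of_lt P.size_pos
  · have hm0 : 0 < m := by rw [hm]; positivity
    have : NeZero m := ⟨hm0.ne'⟩
    obtain ⟨P', hP'⟩ := P.exists_lift (m := m)
    refine ⟨P', hP'.trans ?_⟩
    rw [mul_comm]
    exact Nat.mul_le_mul_right _ (query_overhead_le hm0 _)

end UpperBound

end BlockLift

namespace BlockLift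

/-! ### Few pointers are unspread, few rows are rigid -/

section Spread

open Finset

theorem card_cylinder {ι α : Type*} [Fintype ι] [DecidableEq ι] [Fintype α] [DecidableEq α]
    (I : Finset ι) (a : ι → α) :
    #{x : ι → α | ∀ i ∈ I, x i = a i} * Fintype.card α ^ #I =
      Fintype.card α ^ Fintype.card ι := by
  have h : ({x : ι → α | ∀ i ∈ I, x i = a i} : Finset (ι → α)) =
      Fintype.piFinset fun i => if i ∈ I then {a i} else univ := by
    ext x
    simp only [mem_filter, mem_univ, true_and, Fintype.mem_piFinset]
    refine forall_congr' fun i => ?_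
    by_cases hi : i ∈ I <;> simp [hi]
  have h₂ : Fintype.card α ^ #I = ∏ i, if i ∈ I then Fintype.card α else 1 := by
    rw [prod_ite_mem, univ_inter, prod_const]
  rw [h, Fintype.card_piFinset, h₂, ← prod_mul_distrib]
  calc _ = ∏ _i : ι, Fintype.card α := by
        refine prod_congr rfl fun i _ => ?_
        by_cases hi : i ∈ I <;> simp [hi]
    _ = _ := by simp

/-- Every nonempty finite set has a least element. -/
def HasLeast {α : Type*} (le : α → α → Prop) : Prop :=
  ∀ A : Finset α, A.Nonempty → ∃ a ∈ A, ∀ x ∈ A, le a x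

theorem hasLeast_linearOrder {α : Type*} (o : LinearOrder α) : HasLeast o.le :=
  fun A hA => ⟨A.min' hA, A.min'_mem hA, fun x hx => A.min'_le x hx⟩

open Classical in
/-- The pointers outside `E` above which, for no small set `I` of blocks, the pointers outside `E`
that agree on `I` are spread on the other blocks, that is, escape from all families of `n` sets of
size at most `b`. -/
noncomputable def unspread {n m : ℕ} (s q b : ℕ)
    (le : (Fin n → Fin m) → (Fin n → Fin m) → Prop) (E : Finset (Fin n → Fin m)) :
    Finset (Fin n → Fin m) :=
  {x | x ∉ E ∧ ¬ ∃ I : Finset (Fin n), q ^ #I ≤ s ∧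
    ∀ B : Fin n → Finset (Fin m), (∀ i, #(B i) ≤ b) →
      ∃ x', x' ∉ E ∧ le x x' ∧ (∀ i ∈ I, x' i = x i) ∧ ∀ i ∉ I, x' i ∉ B i}

/-- A density increment: were the unspread set large, its piece maximising `#(P c) * q ^ (4 * #c.1)`
would be spread outside the fixed blocks. The whole piece lies above its least element, which would
then not be unspread. -/
theorem card_unspread_lt {n m s q b : ℕ} (hm : m = q ^ 5) (hq : 0 < q) (hb : n * b < q ^ 4)
    {le : (Fin n → Fin m) → (Fin n → Fin m) → Prop} (hle : HasLeast le)
    (E : Finset (Fin n → Fin m)) : s * #(unspread s q b le E) < m ^ n := by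
  classical
  by_contra! hA
  set A := unspread s q b le E
  have hm0 : 0 < m := by rw [hm]; positivity
  have hmn : 0 < m ^ n := by positivity
  have hA0 : 0 < #A := Nat.pos_of_mul_pos_left (hmn.trans_le hA)
  have : NeZero m := ⟨hm0.ne'⟩
  let P : Finset (Fin n) × (Fin n → Fin m) → Finset (Fin n → Fin m) :=
    fun c => {x ∈ A | ∀ i ∈ c.1, x i = c.2 i}
  obtain ⟨⟨I, α⟩, hmax⟩ := Finite.exists_max fun c => #(P c) * q ^ (4 * #c.1)
  have hempty : #A ≤ #(P (I, α)) * q ^ (4 * #I) := by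
    simpa [P] using hmax (∅, 0)
  have hP0 : 0 < #(P (I, α)) := Nat.pos_of_mul_pos_right (hA0.trans_le hempty)
  have hPle : #(P (I, α)) * m ^ #I ≤ m ^ n := by
    have := card_cylinder I α
    simp only [Fintype.card_fin] at this
    rw [← this]
    refine Nat.mul_le_mul_right _ (card_le_card ?_)
    intro x hx
    simpa using (mem_filter.1 hx).2
  have hIs : q ^ #I ≤ s := by
    -- Fixing a block costs a factor `m = q ^ 5` in the cylinder but gains only `q ^ 4` in the
    -- maximised quantity; the spare `q` per block bounds `#I`.
    have h1 : m ^ n * q ^ #I ≤ m ^ n * s := by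
      calc m ^ n * q ^ #I ≤ s * (#(P (I, α)) * q ^ (4 * #I)) * q ^ #I :=
            Nat.mul_le_mul_right _ (hA.trans (Nat.mul_le_mul_left _ hempty))
        _ = #(P (I, α)) * (q ^ 5) ^ #I * s := by ring
        _ = #(P (I, α)) * m ^ #I * s := by rw [← hm]
        _ ≤ m ^ n * s := Nat.mul_le_mul_right _ hPle
    exact Nat.le_of_mul_le_mul_left h1 hmn
  obtain ⟨x₀, hx₀, hmin⟩ := hle (P (I, α)) (card_pos.1 hP0)
  have hx₀A : x₀ ∈ A := (mem_filter.1 hx₀).1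
  have hx₀I := (mem_filter.1 hx₀).2
  have hbad := (mem_filter.1 hx₀A).2.2
  refine hbad ⟨I, hIs, fun B hB => ?_⟩
  by_contra! hno
  have hcover : P (I, α) ⊆ Iᶜ.biUnion fun i => (B i).biUnion fun a =>
      {x ∈ P (I, α) | x i = a} := by
    intro x hx
    have hxA : x ∈ A := (mem_filter.1 hx).1
    obtain ⟨i, hi, hxi⟩ := hno x (mem_filter.1 hxA).2.1 (hmin x hx) fun i hi =>
      ((mem_filter.1 hx).2 i hi).trans (hx₀I i hi).symm
    simp only [mem_biUnion, mem_compl, mem_filter]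
    exact ⟨i, hi, x i, hxi, hx, rfl⟩
  -- Maximality against fixing the further block `i` to `a`. At most `n * b < q ^ 4` such pieces
  -- cannot then cover `P (I, α)`.
  have hpiece : ∀ i ∉ I, ∀ a, #{x ∈ P (I, α) | x i = a} * q ^ 4 ≤ #(P (I, α)) := by
    intro i hi a
    have h1 := hmax (insert i I, Function.update α i a)
    have h2 : ({x ∈ P (I, α) | x i = a} : Finset _) ⊆
        P (insert i I, Function.update α i a) := by
      intro x hx
      obtain ⟨hx, hxi⟩ := mem_filter.1 hx
      obtain ⟨hxA, hxI⟩ := mem_filter.1 hx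
      refine mem_filter.2 ⟨hxA, fun k hk => ?_⟩
      by_cases hki : k = i
      · subst hki
        simpa using hxi
      · simpa [hki] using hxI k ((mem_insert.1 hk).resolve_left hki)
    simp only [card_insert_of_notMem hi] at h1
    have h3 : #{x ∈ P (I, α) | x i = a} * q ^ 4 * q ^ (4 * #I) ≤
        #(P (I, α)) * q ^ (4 * #I) := by
      calc _ = #{x ∈ P (I, α) | x i = a} * q ^ (4 * (#I + 1)) := by ring
        _ ≤ _ := (Nat.mul_le_mul_right _ (card_le_card h2)).trans h1
    exact Nat.le_of_mul_le_mul_right h3 (by positivity)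
  have hcount : #(P (I, α)) * q ^ 4 ≤ n * b * #(P (I, α)) := by
    calc #(P (I, α)) * q ^ 4
        ≤ (∑ i ∈ Iᶜ, ∑ a ∈ B i, #{x ∈ P (I, α) | x i = a}) * q ^ 4 := by
          refine Nat.mul_le_mul_right _ ((card_le_card hcover).trans ?_)
          exact card_biUnion_le.trans (sum_le_sum fun i _ => card_biUnion_le)
      _ = ∑ i ∈ Iᶜ, ∑ a ∈ B i, #{x ∈ P (I, α) | x i = a} * q ^ 4 := by
          simp only [sum_mul]
      _ ≤ ∑ i ∈ Iᶜ, ∑ _a ∈ B i, #(P (I, α)) :=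
          sum_le_sum fun i hi => sum_le_sum fun a _ => hpiece i (mem_compl.1 hi) a
      _ ≤ ∑ _i ∈ Iᶜ, b * #(P (I, α)) := by
          refine sum_le_sum fun i _ => ?_
          rw [sum_const, smul_eq_mul]
          exact Nat.mul_le_mul_right _ (hB i)
      _ ≤ n * b * #(P (I, α)) := by
          rw [sum_const, smul_eq_mul, mul_assoc]
          exact Nat.mul_le_mul_right _ ((card_le_univ _).trans (by simp))
  have := Nat.mul_lt_mul_of_pos_right hb hP0
  linarith [mul_comm (q ^ 4) (#(P (I, α)))]

open Classical in
/-- The columns on which all the rows above `y` and outside `E` agree. -/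
noncomputable def constantColumns {m : ℕ} (le : (Fin m → Bool) → (Fin m → Bool) → Prop)
    (E : Finset (Fin m → Bool)) (y : Fin m → Bool) : Finset (Fin m) :=
  {c | ∃ b, ∀ y', y' ∉ E → le y y' → y' c = b}

open Classical in
/-- The rows `y` outside `E` such that the rows above `y` and outside `E` agree on more than `K`
columns. -/
noncomputable def rigid {m : ℕ} (K : ℕ) (le : (Fin m → Bool) → (Fin m → Bool) → Prop)
    (E : Finset (Fin m → Bool)) : Finset (Fin m → Bool) :=
  {y | y ∉ E ∧ K < #(constantColumns le E y)}

/-- All rigid rows lie outside `E` and above the least of them, so they agree on its constant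
columns, of which there are at least `K + 1`. -/
theorem card_rigid_le {m K : ℕ} {le : (Fin m → Bool) → (Fin m → Bool) → Prop}
    (hle : HasLeast le) (E : Finset (Fin m → Bool)) :
    #(rigid K le E) * 2 ^ (K + 1) ≤ 2 ^ m := by
  classical
  rcases (rigid K le E).eq_empty_or_nonempty with h | h
  · simp [h]
  obtain ⟨y₀, hy₀, hmin⟩ := hle _ h
  have hK : K < #(constantColumns le E y₀) := (mem_filter.1 hy₀).2.2
  have hconst : ∀ c : Fin m, ∃ b, c ∈ constantColumns le E y₀ →
      ∀ y', y' ∉ E → le y₀ y' → y' c = b := by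
    intro c
    by_cases hc : c ∈ constantColumns le E y₀
    · obtain ⟨b, hb⟩ := (mem_filter.1 hc).2
      exact ⟨b, fun _ => hb⟩
    · exact ⟨true, fun h => absurd h hc⟩
  choose g hg using hconst
  have hcard := card_cylinder (constantColumns le E y₀) g
  simp only [Fintype.card_bool, Fintype.card_fin] at hcard
  rw [← hcard]
  refine Nat.mul_le_mul (card_le_card ?_) (Nat.pow_le_pow_right (by norm_num) hK)
  intro y hy
  simp only [mem_filter, mem_univ, true_and]
  exact fun c hc => hg c hc y (mem_filter.1 hy).2.1 (hmin y hy)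

theorem exists_row_notMem {m : ℕ} {E : Finset (Fin m → Bool)} (hE : 2 * #E < 2 ^ m) (c : Fin m)
    (b : Bool) : ∃ y, y ∉ E ∧ y c = b := by
  by_contra! h
  have hcard := card_cylinder {c} fun _ : Fin m => b
  simp only [mem_singleton, forall_eq, Fintype.card_bool, Fintype.card_fin, card_singleton,
    pow_one] at hcard
  have : #{y : Fin m → Bool | y c = b} ≤ #E := by
    refine card_le_card fun y hy => ?_
    by_contra hyE
    exact h y hyE (mem_filter.1 hy).2
  omega

end Spread

/-! ### Errors accumulated from the leaves upwards -/

section Accumulate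

open Finset

variable {α V : Type*} [DecidableEq α] [Fintype V]

/-- The errors of the vertices of rank less than `k`, where the error of a vertex depends on the
union of the errors of the vertices of smaller rank. -/
def accumulate (rank : V → ℕ) (err : V → Finset α → Finset α) : ℕ → Finset α
  | 0 => ∅
  | k + 1 => accumulate rank err k ∪
      ({v | rank v = k} : Finset V).biUnion fun v => err v (accumulate rank err k)

variable (rank : V → ℕ) (err : V → Finset α → Finset α)

theorem accumulate_mono : Monotone (accumulate rank err) :=
  monotone_nat_of_le_succ fun _ => subset_union_left

theorem err_subset_accumulate {v : V} {k : ℕ} (hk : rank v < k) :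
    err v (accumulate rank err (rank v)) ⊆ accumulate rank err k := by
  refine subset_trans ?_ (accumulate_mono rank err (Nat.succ_le_of_lt hk))
  intro x hx
  simp only [accumulate, mem_union, mem_biUnion, mem_filter, mem_univ,
    true_and]
  exact Or.inr ⟨v, rfl, hx⟩

theorem accumulate_subset (k : ℕ) : accumulate rank err k ⊆
    univ.biUnion fun v => err v (accumulate rank err (rank v)) := by
  induction k with
  | zero => exact empty_subset _
  | succ k ih =>
    refine union_subset ih fun x hx => ?_
    simp only [mem_biUnion, mem_filter, mem_univ, true_and] at hx ⊢
    obtain ⟨v, rfl, hx⟩ := hx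
    exact ⟨v, hx⟩

theorem card_accumulate_le (k : ℕ) : #(accumulate rank err k) ≤
    ∑ v, #(err v (accumulate rank err (rank v))) :=
  (card_le_card (accumulate_subset rank err k)).trans card_biUnion_le

end Accumulate

end BlockLift

namespace BlockLift

/-! ### From a simplex-dag to small block-width -/

section LowerBound

open Finset

/-- If `x` is not unspread and no row of `y` is rigid, then the part of an upward closed set `T`
above `(x, y)` contains, for a single pointer tuple `x'`, preimages of all the gadget outputs that
agree with the output on `(x, y)` in a small set `I` of blocks that depends on `x` only. -/
theorem exists_spread_blocks {n ℓ m s q K : ℕ}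
    {leX : (Fin n → Fin m) → (Fin n → Fin m) → Prop}
    {leY : Fin n → Fin ℓ → (Fin m → Bool) → (Fin m → Bool) → Prop}
    (hrefl : ∀ i j y, leY i j y y)
    {T : (Fin n → Fin m) → (Fin n → Fin ℓ → Fin m → Bool) → Prop}
    (hT : ∀ x y x' y', leX x x' → (∀ i j, leY i j (y i j) (y' i j)) → T x y → T x' y')
    {EX : Finset (Fin n → Fin m)} {EY : Fin n → Fin ℓ → Finset (Fin m → Bool)}
    {x : Fin n → Fin m} (hxE : x ∉ EX) (hx : x ∉ unspread s q (ℓ * K) leX EX) :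
    ∃ I : Finset (Fin n), q ^ #I ≤ s ∧ ∀ y, T x y → (∀ i j, y i j ∉ EY i j) →
      (∀ i j, y i j ∉ rigid K (leY i j) (EY i j)) → ∃ x', x' ∉ EX ∧
        ∀ z : BlockInput n ℓ, (∀ i ∈ I, z i = colIndex (x i) (y i)) →
          ∃ y', (∀ i j, y' i j ∉ EY i j) ∧ T x' y' ∧ (fun i => colIndex (x' i) (y' i)) = z := by
  classical
  have hx' := hx
  simp only [unspread, mem_filter, mem_univ, true_and, not_and, not_not] at hx'
  obtain ⟨I, hI, hspread⟩ := hx' hxE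
  refine ⟨I, hI, fun y hTy hyE hy => ?_⟩
  -- Outside `I`, the new pointers avoid every column on which some row of the block is forced, so
  -- each selected bit can be set freely by moving its row up.
  obtain ⟨x', hx'E, hxx', hx'I, hx'B⟩ := hspread
    (fun i => univ.biUnion fun j => constantColumns (leY i j) (EY i j) (y i j)) fun i => by
      refine card_biUnion_le.trans ((sum_le_card_nsmul _ _ K fun j _ => ?_).trans (by simp))
      by_contra! h
      exact hy i j (mem_filter.2 ⟨mem_univ _, hyE i j, h⟩)
  refine ⟨x', hx'E, fun z hz => ?_⟩
  have hrow : ∀ i j, ∃ r, r ∉ EY i j ∧ leY i j (y i j) r ∧ r (x' i) = z i j := by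
    intro i j
    by_cases hi : i ∈ I
    · refine ⟨y i j, hyE i j, hrefl _ _ _, ?_⟩
      rw [hx'I i hi, hz i hi, colIndex]
    · have hc : x' i ∉ constantColumns (leY i j) (EY i j) (y i j) := fun h =>
        hx'B i hi (mem_biUnion.2 ⟨j, mem_univ _, h⟩)
      simp only [constantColumns, mem_filter, mem_univ, true_and, not_exists, not_forall] at hc
      obtain ⟨r, hrE, hr, hrz⟩ := hc (!z i j)
      exact ⟨r, hrE, hr, by simpa using hrz⟩
  choose y' hy'E hyy' hy'z using hrow
  exact ⟨y', hy'E, hT x y x' y' hxx' hyy' hTy, funext fun i => funext fun j => hy'z i j⟩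

/-- The input of the players for given pointers and matrices. -/
def splitParts {n ℓ m : ℕ} (x : Fin n → Fin m) (y : Fin n → Fin ℓ → Fin m → Bool) :
    ∀ p, Part n ℓ m p
  | none => x
  | some (i, j) => y i j

/-- Each `I` produced by spreading has `q ^ #I ≤ P.size < q ^ (w + 1)`, hence at most `w` blocks;
the factor 3 counts a vertex and its two children. -/
theorem bw_le_of_simplexDag {n ℓ m q w : ℕ} {O : Type*} {S : SearchProblem (BlockInput n ℓ) O}
    (hS : TotalSearch S) (hq : q = n * ℓ) (hq2 : 2 ≤ q)
    (hm : m = q ^ 5)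
    (P : SimplexDag (partite (compInd S m))) (hPq : P.size ≤ q ^ q)
    (hPw : P.size < q ^ (w + 1)) : bw S ≤ 3 * w := by
  classical
  obtain ⟨rank, hrank⟩ := P.exists_rank
  choose ord hord using fun v => (P.label v).2
  have hs0 : 0 < P.size := P.size_pos
  have hm0 : 0 < m := by rw [hm]; positivity
  -- Large enough that `2 ^ K` beats twice the dag size, small enough that `n * (ℓ * K) = q ^ 2 * (q
  -- + 1)` stays below `q ^ 4`.
  set K := q * (q + 1) with hK
  have hsK : 2 * P.size ≤ 2 ^ K := by
    calc 2 * P.size ≤ 2 * q ^ q := Nat.mul_le_mul_left _ hPq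
      _ ≤ 2 * (2 ^ q) ^ q := Nat.mul_le_mul_left _ (Nat.pow_le_pow_left Nat.lt_two_pow_self.le _)
      _ = 2 ^ (q * q + 1) := by rw [← pow_mul, pow_succ]; ring
      _ ≤ 2 ^ K := Nat.pow_le_pow_right (by norm_num) (by rw [hK]; nlinarith)
  have hb : n * (ℓ * K) < q ^ 4 := by
    have h1 : n * (ℓ * K) = q ^ 2 * (q + 1) := by rw [hK, ← mul_assoc, ← hq]; ring
    have h2 : q ^ 4 = q ^ 2 * q ^ 2 := by ring
    rw [h1, h2]
    exact Nat.mul_lt_mul_of_pos_left (by nlinarith) (by positivity)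
  let leX : Fin P.size → (Fin n → Fin m) → (Fin n → Fin m) → Prop := fun v => (ord v none).le
  let leY : Fin P.size → Fin n → Fin ℓ → (Fin m → Bool) → (Fin m → Bool) → Prop :=
    fun v i j => (ord v (some (i, j))).le
  let T : Fin P.size → (Fin n → Fin m) → (Fin n → Fin ℓ → Fin m → Bool) → Prop :=
    fun v x y => splitParts x y ∈ simplexFeas (P.label v)
  have hT : ∀ v x y x' y', leX v x x' → (∀ i j, leY v i j (y i j) (y' i j)) →
      T v x y → T v x' y' := by
    intro v x y x' y' hx hy h
    refine hord v _ _ ?_ h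
    rintro (_ | ⟨i, j⟩)
    · exact hx
    · exact hy i j
  have hrefl : ∀ v i j y, leY v i j y y := fun v i j y => (ord v (some (i, j))).le_refl y
  let errX : Fin P.size → Finset (Fin n → Fin m) → Finset (Fin n → Fin m) :=
    fun v => unspread P.size q (ℓ * K) (leX v)
  let errY : Fin n → Fin ℓ → Fin P.size → Finset (Fin m → Bool) → Finset (Fin m → Bool) :=
    fun i j v => rigid K (leY v i j)
  let EX := accumulate rank errX
  let EY := fun i j => accumulate rank (errY i j)
  have hEX : ∀ k, #(EX k) < m ^ n := by
    intro k
    refine (card_accumulate_le rank errX k).trans_lt ?_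
    have h1 : ∀ v, P.size * #(errX v (EX (rank v))) < m ^ n := fun v =>
      card_unspread_lt hm (by omega) hb (hasLeast_linearOrder (ord v none)) _
    have h2 : P.size * ∑ v, #(errX v (EX (rank v))) < P.size * m ^ n := by
      rw [mul_sum]
      calc _ < ∑ _v : Fin P.size, m ^ n := sum_lt_sum_of_nonempty ⟨P.root, mem_univ _⟩ fun v _ => h1 v
        _ = P.size * m ^ n := by simp
    exact Nat.lt_of_mul_lt_mul_left h2
  have hEY : ∀ i j k, 2 * #(EY i j k) < 2 ^ m := by
    intro i j k
    have h1 : ∀ v, #(errY i j v (EY i j (rank v))) * 2 ^ (K + 1) ≤ 2 ^ m := fun v =>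
      card_rigid_le (hasLeast_linearOrder (ord v (some (i, j)))) _
    have h2 : #(EY i j k) * 2 ^ (K + 1) ≤ P.size * 2 ^ m := by
      calc _ ≤ (∑ v, #(errY i j v (EY i j (rank v)))) * 2 ^ (K + 1) :=
            Nat.mul_le_mul_right _ (card_accumulate_le rank (errY i j) k)
        _ ≤ ∑ _v : Fin P.size, 2 ^ m := by
            rw [sum_mul]
            exact sum_le_sum fun v _ => h1 v
        _ = P.size * 2 ^ m := by simp
    have h3 : #(EY i j k) * (4 * P.size) ≤ 2 ^ m * P.size := by
      calc _ ≤ #(EY i j k) * 2 ^ (K + 1) := Nat.mul_le_mul_left _ (by rw [pow_succ]; omega)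
        _ ≤ P.size * 2 ^ m := h2
        _ = 2 ^ m * P.size := mul_comm _ _
    have h4 : #(EY i j k) * 4 ≤ 2 ^ m := by
      rw [← mul_assoc] at h3
      exact Nat.le_of_mul_le_mul_right h3 hs0
    have : 0 < 2 ^ m := by positivity
    omega
  have hcardI : ∀ I : Finset (Fin n), q ^ #I ≤ P.size → #I ≤ w := fun I hI =>
    Nat.lt_succ_iff.1 ((Nat.pow_lt_pow_iff_right (by omega)).1 (hI.trans_lt hPw))
  -- Errors at `rank v` include those of the children of `v` but not of `v` itself, which is what
  -- the descent consumes.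
  have claim : ∀ k v, rank v = k → ∀ (I : Finset (Fin n)) (z₀ : BlockInput n ℓ) x,
      q ^ #I ≤ P.size → x ∉ EX (rank v) →
      (∀ z : BlockInput n ℓ, (∀ i ∈ I, z i = z₀ i) → ∃ y, (∀ i j, y i j ∉ EY i j (rank v)) ∧
        T v x y ∧ (fun i => colIndex (x i) (y i)) = z) →
      Solved S (3 * w) (blockConj I z₀) := by
    intro k
    induction k using Nat.strong_induction_on with
    | _ k ih =>
    rintro v rfl I z₀ x hI hxE hx
    have hIw := hcardI I hI
    cases hv : P.child v with
    | none =>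
      obtain ⟨o, ho⟩ := P.leaf v hv
      refine Solved.of_leaf (((Conj.blockWidth_le_of_subset (blocks_blockConj_subset I z₀)).trans
        hIw).trans (by omega)) ⟨o, fun z hz => ?_⟩
      obtain ⟨y, -, hTy, hyz⟩ := hx z (mem_feas_blockConj.1 hz)
      have := ho _ hTy
      rwa [← hyz]
    | some c =>
      obtain ⟨u, u'⟩ := c
      -- `I'` is chosen before `y`, so it can be queried before knowing which matrices realise the
      -- output.
      have hchild : ∀ u, rank u < rank v → ∃ I' : Finset (Fin n), q ^ #I' ≤ P.size ∧
          ∀ y, T u x y → (∀ i j, y i j ∉ EY i j (rank v)) →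
            Solved S (3 * w) (blockConj I' fun i => colIndex (x i) (y i)) := by
        intro u hu
        obtain ⟨I', hI', h⟩ := exists_spread_blocks (EY := fun i j => EY i j (rank u))
          (K := K) (hrefl u) (hT u)
          (fun h => hxE (accumulate_mono rank errX hu.le h))
          (fun h => hxE (err_subset_accumulate rank errX hu h))
        refine ⟨I', hI', fun y hTy hyE => ?_⟩
        obtain ⟨x', hx'E, hx'⟩ := h y hTy
          (fun i j h => hyE i j (accumulate_mono rank (errY i j) hu.le h))
          (fun i j h => hyE i j (err_subset_accumulate rank (errY i j) hu h))
        exact ih (rank u) hu u rfl I' _ x' hI' hx'E hx'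
      obtain ⟨I₁, hI₁, h₁⟩ := hchild u (hrank v u u' hv).1
      obtain ⟨I₂, hI₂, h₂⟩ := hchild u' (hrank v u u' hv).2
      refine Solved.of_query_blocks hS (J := I ∪ I₁ ∪ I₂) ?_
        ((blocks_blockConj_subset I z₀).trans
          (subset_union_left.trans subset_union_left)) fun z hz => ?_
      · have := hcardI I₁ hI₁
        have := hcardI I₂ hI₂
        have := card_union_le (I ∪ I₁) I₂
        have := card_union_le I I₁
        omega
      · obtain ⟨y, hyE, hTy, rfl⟩ := hx z (mem_feas_blockConj.1 hz)
        rcases P.nonleaf v u u' hv hTy with hu | hu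
        · exact ⟨_, mem_feas_blockConj.2 fun _ _ => rfl, (blocks_blockConj_subset _ _).trans
            (subset_union_right.trans subset_union_left), h₁ y hu hyE⟩
        · exact ⟨_, mem_feas_blockConj.2 fun _ _ => rfl, (blocks_blockConj_subset _ _).trans
            subset_union_right, h₂ y hu hyE⟩
  obtain ⟨x, hx⟩ : ∃ x, x ∉ EX (rank P.root) := by
    by_contra! h
    have h1 := hEX (rank P.root)
    rw [eq_univ_iff_forall.2 h] at h1
    simp at h1
  -- At the root nothing is fixed: fewer than half of the rows are discarded, so either bit value
  -- survives at the column selected by `x`.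
  have hroot := claim _ P.root rfl ∅ (fun _ _ => false) x (by simpa using Nat.succ_le_of_lt hs0) hx fun z _ => by
    choose y hyE hyz using fun i j => exists_row_notMem (hEY i j (rank P.root)) (x i) (z i j)
    refine ⟨y, hyE, ?_, funext fun i => funext fun j => hyz i j⟩
    change _ ∈ simplexFeas (P.label P.root)
    rw [P.root_full]
    trivial
  exact bw_le_of_solved (by simpa [blockConj] using hroot)

theorem rpow_le_simDag {n ℓ m : ℕ} (hm : m = (n * ℓ) ^ 5) {O : Type*}
    {S : SearchProblem (BlockInput n ℓ) O} (hS : TotalSearch S)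
    (h : Nonempty (SimplexDag (partite (compInd S m)))) :
    (m : ℝ) ^ ((1 / 15 : ℝ) * (bw S : ℝ)) ≤ (simDag (partite (compInd S m)) : ℝ) := by
  have hpos : (1 : ℝ) ≤ simDag (partite (compInd S m)) := by exact_mod_cast leastSize_pos h
  have hbw : bw S ≤ n := bw_le_of_solved (solved_all_blocks hS)
  obtain ⟨q, hq⟩ : ∃ q, q = n * ℓ := ⟨_, rfl⟩
  rw [← hq] at hm
  subst hm
  rcases Nat.lt_trichotomy q 1 with h0 | h1 | h2
  · have : bw S = 0 := by
      obtain rfl : q = 0 := by omega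
      obtain ⟨P, -⟩ := (solved_all_blocks hS).exists_dag
      exact Nat.le_zero.1 ((bw_le_blockWidth P).trans (blockWidth_eq_zero hq.symm P).le)
    simpa [this] using hpos
  · simpa [h1] using hpos
  · have hqR : (1 : ℝ) ≤ q := by exact_mod_cast h2.le
    have hrpow : ∀ w : ℕ, bw S ≤ 3 * w →
        (((q ^ 5 : ℕ) : ℝ)) ^ ((1 / 15 : ℝ) * (bw S : ℝ)) ≤ ((q ^ w : ℕ) : ℝ) := by
      intro w hw
      have hw' : (bw S : ℝ) ≤ 3 * w := by exact_mod_cast hw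
      push_cast
      rw [← Real.rpow_natCast (q : ℝ) 5, ← Real.rpow_mul (by positivity),
        ← Real.rpow_natCast (q : ℝ) w]
      refine Real.rpow_le_rpow_of_exponent_le hqR ?_
      push_cast
      linarith
    obtain ⟨P, hP⟩ := exists_dag_leastSize h
    change P.size = simDag _ at hP
    rw [← hP]
    -- Here `w` is the integer part of the base-`q` logarithm of the size, and `m ^ (bw S / 15) = q
    -- ^ (bw S / 3) ≤ q ^ w`. A dag larger than `q ^ q` needs no argument, since `bw S ≤ n ≤ q`.
    by_cases hs : P.size ≤ q ^ q
    · have hlog := bw_le_of_simplexDag hS hq h2 rfl P hs (Nat.lt_pow_succ_log_self h2 _)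
      refine (hrpow _ hlog).trans ?_
      exact_mod_cast Nat.pow_log_le_self q P.size_pos.ne'
    · have hnq : n ≤ q := by
        have : ℓ ≠ 0 := by rintro rfl; simp at hq; omega
        rw [hq]
        exact Nat.le_mul_of_pos_right n (by omega)
      refine (hrpow q (by omega)).trans ?_
      exact_mod_cast (not_le.1 hs).le

end LowerBound

end BlockLift

theorem theorem5 :
    ∃ c : ℝ, 0 < c ∧ ∃ C : ℝ, 0 < C ∧
      ∀ (n ℓ m : ℕ), m = (n * ℓ) ^ 5 →
      ∀ (O : Type*) (S : SearchProblem (BlockInput n ℓ) O), TotalSearch S →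
        -- all the minima below are taken over nonempty sets
        (Nonempty (DecisionDag blockBit S) ∧
          Nonempty (SimplexDag (partite (compInd S m))) ∧
          Nonempty (LTFDag liftedBit (compInd S m)) ∧
          Nonempty (DecisionDag liftedBit (compInd S m))) ∧
        (m : ℝ) ^ (c * (bw S : ℝ)) ≤ (simDag (partite (compInd S m)) : ℝ) ∧
        simDag (partite (compInd S m)) ≤ ltfDag liftedBit (compInd S m) ∧
        ltfDag liftedBit (compInd S m) ≤ decDag liftedBit (compInd S m) ∧
        ∀ P : DecisionDag blockBit S,
          (decDag liftedBit (compInd S m) : ℝ) ≤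
            (m : ℝ) ^ (C * (blockWidth P : ℝ)) * (P.size : ℝ) := by
  refine ⟨1 / 15, by norm_num, 9, by norm_num, fun n ℓ m hm O S hS => ?_⟩
  obtain ⟨P₀, -⟩ := (solved_all_blocks hS).exists_dag
  have hdec : Nonempty (DecisionDag liftedBit (compInd S m)) :=
    (exists_liftedDag hm hS P₀).nonempty
  obtain ⟨hltf, hltf_le⟩ := ltfDag_le_decDag hdec
  obtain ⟨hsim, hsim_le⟩ := simDag_le_ltfDag hltf
  refine ⟨⟨⟨P₀⟩, hsim, hltf, hdec⟩, rpow_le_simDag hm hS hsim, hsim_le, hltf_le, fun P => ?_⟩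
  obtain ⟨P', hP'⟩ := exists_liftedDag hm hS P
  have h : decDag liftedBit (compInd S m) ≤ m ^ (9 * blockWidth P) * P.size :=
    (leastSize_le P').trans hP'
  have hpow : (m : ℝ) ^ ((9 : ℝ) * (blockWidth P : ℝ)) = ((m ^ (9 * blockWidth P) : ℕ) : ℝ) := by
    rw [Nat.cast_pow, ← Real.rpow_natCast]
    push_cast
    rfl
  rw [hpow]
  exact_mod_cast h
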